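/- For a finite set $P$ of points in the Euclidean plane, the visibility graph of $P$ has the points of $P$ as its vertices, and two distinct points $p,q\in P$ are adjacent if and only if the closed segment $pq$ contains no point of $P$ other than $p$ and $q$. A point visibility graph is a graph $G$ that is isomorphic to the visibility graph of some finite set of points in the plane. A graph is a path if its vertices can be listed as $v_1,\dots,v_n$ (for some $n\ge 0$) so that its edges are exactly the pairs $v_iv_{i+1}$, $1\le i<n$. Theorem. If $G$ is a point visibility graph that is not a path, then $G$ has a Hamiltonian cycle, that is, a cycle that passes through every vertex of $G$ exactly once. -/

import Mathlib

/-- The visibility graph of a set `P` of points in the Euclidean plane: the vertices are the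
points of `P`, and two distinct points are adjacent when the closed segment joining them
contains no point of `P` other than its two endpoints. -/
def pointVisibilityGraph (P : Set (EuclideanSpace ℝ (Fin 2))) : SimpleGraph P where
  Adj x y := x ≠ y ∧
    P ∩ segment ℝ (x : EuclideanSpace ℝ (Fin 2)) (y : EuclideanSpace ℝ (Fin 2)) =
      {(x : EuclideanSpace ℝ (Fin 2)), (y : EuclideanSpace ℝ (Fin 2))}
  symm := ⟨fun x y h => ⟨h.1.symm, by rw [segment_symm, h.2, Set.pair_comm]⟩⟩
  loopless := ⟨fun _ h => h.1 rfl⟩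

/-- `G` is a point visibility graph (PVG): it is isomorphic to the visibility graph of some
finite set of points in the plane. -/
def IsPVG {V : Type*} (G : SimpleGraph V) : Prop :=
  ∃ P : Finset (EuclideanSpace ℝ (Fin 2)),
    Nonempty (G ≃g pointVisibilityGraph (P : Set (EuclideanSpace ℝ (Fin 2))))

/-- The whole graph `G` is a path: its vertices can be listed as `v₀, …, vₙ₋₁` so that the edges
are exactly the pairs of consecutive vertices (`n = 0, 1, 2` allowed). -/
def IsPathGraph {V : Type*} (G : SimpleGraph V) : Prop :=
  ∃ n : ℕ, Nonempty (G ≃g SimpleGraph.pathGraph n)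

namespace SimpleGraph

/-! Take an extreme point `p` of the set and sort the other points by slope as seen from `p`, ties
by distance. Consecutive points see each other, since a blocker would come strictly between them in
this order. Listing rays outwards lets `p` see the first point; listing the last ray inwards lets it
see the last one, which closes the cycle. The two conventions clash only if there is a single ray:
then all points are collinear and the graph is a path. -/

/-- A graph on a finite linear order in which covering pairs are adjacent, and so are the least and
the greatest element, has a Hamiltonian cycle. -/
theorem exists_isHamiltonianCycle_of_covBy {V : Type*} [Fintype V] [DecidableEq V] [LinearOrder V]
    (G : SimpleGraph V) (hcard : 2 < Fintype.card V) (hcov : ∀ a b : V, a ⋖ b → G.Adj a b)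
    (hends : ∀ a b : V, IsBot a → IsTop b → G.Adj a b) :
    ∃ (v : V) (c : G.Walk v v), c.IsHamiltonianCycle := by
  have e := Fintype.orderIsoFinOfCardEq V rfl
  have hsucc : ∀ i j : Fin (Fintype.card V), (i : ℕ) + 1 = j → G.Adj (e i) (e j) := fun i j h ↦
    hcov _ _ ((apply_covBy_apply_iff e).2 (Fin.covBy_iff.2 (Nat.covBy_iff_add_one_eq.2 h)))
  have hlast : ∀ i j : Fin (Fintype.card V), (i : ℕ) = 0 → (j : ℕ) + 1 = Fintype.card V →
      G.Adj (e i) (e j) := fun i j hi hj ↦ by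
    refine hends _ _ (fun x ↦ ?_) (fun x ↦ ?_)
    · rw [← e.apply_symm_apply x, e.le_iff_le, Fin.le_def]
      omega
    · rw [← e.apply_symm_apply x, e.le_iff_le, Fin.le_def]
      omega
  -- Subtraction in `Fin` wraps around, so a difference of 1 is either a successor step or the
  -- closing edge between last and first.
  have hsub : ∀ i j : Fin (Fintype.card V), (i - j).val = 1 → G.Adj (e i) (e j) := fun i j h ↦ by
    rcases le_or_gt j i with hji | hij
    · rw [Fin.sub_val_of_le hji] at h
      exact (hsucc j i (by rw [Fin.le_def] at hji; omega)).symm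
    · rw [Fin.coe_sub_iff_lt.2 hij] at h
      exact hlast i j (by omega) (by omega)
  have hadj : ∀ {i j : Fin (Fintype.card V)}, (cycleGraph _).Adj i j → G.Adj (e i) (e j) :=
    fun h ↦ (cycleGraph_adj'.1 h).elim (hsub _ _) (fun h ↦ (hsub _ _ h).symm)
  obtain ⟨v, c, hc, hlen⟩ := (cycleGraph_isContained_iff (G := G) hcard).1
    ⟨⟨⟨e, hadj⟩, e.injective⟩⟩
  exact ⟨v, c, Walk.isHamiltonianCycle_iff_isCycle_and_length_eq.2 ⟨hc, hlen⟩⟩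

theorem isPathGraph_of_covBy {V : Type*} [Fintype V] [LinearOrder V] (G : SimpleGraph V)
    (hcov : ∀ a b : V, a < b → (G.Adj a b ↔ a ⋖ b)) : IsPathGraph G := by
  have e := Fintype.orderIsoFinOfCardEq V rfl
  refine ⟨Fintype.card V, ⟨⟨e.symm.toEquiv, fun {a b} ↦ ?_⟩⟩⟩
  change (e.symm a ⋖ e.symm b ∨ e.symm b ⋖ e.symm a) ↔ G.Adj a b
  rw [apply_covBy_apply_iff, apply_covBy_apply_iff]
  rcases lt_trichotomy a b with h | rfl | h
  · rw [hcov a b h]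
    exact or_iff_left fun h' ↦ h.asymm h'.lt
  · simp
  · rw [G.adj_comm, hcov b a h]
    exact or_iff_right fun h' ↦ h.asymm h'.lt

/-- `c` lies in the open segment from `a` to `b`, in terms of two coordinate functions. -/
def IsBetween {V : Type*} (f g : V → ℝ) (a c b : V) : Prop :=
  ∃ t : ℝ, 0 < t ∧ t < 1 ∧ f c = (1 - t) * f a + t * f b ∧ g c = (1 - t) * g a + t * g b

/-! ### Betweenness and slopes in coordinates -/

section Coordinates

variable {V : Type*} {f g : V → ℝ}

theorem IsBetween.sub_const {a c b : V} (h : IsBetween f g a c b) (r s : ℝ) :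
    IsBetween (fun x ↦ f x - r) (fun x ↦ g x - s) a c b := by
  obtain ⟨t, h0, h1, hf, hg⟩ := h
  exact ⟨t, h0, h1, by simp only [hf]; ring, by simp only [hg]; ring⟩

theorem IsBetween.of_sub_const {a c b : V} {r s : ℝ}
    (h : IsBetween (fun x ↦ f x - r) (fun x ↦ g x - s) a c b) : IsBetween f g a c b := by
  simpa using h.sub_const (-r) (-s)

theorem IsBetween.pos {a c b : V} (h : IsBetween f g a c b) (ha : 0 ≤ f a) (hb : 0 < f b) :
    0 < f c := by
  obtain ⟨t, h0, h1, hf, -⟩ := h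
  rw [hf]
  have := mul_nonneg (sub_nonneg.2 h1.le) ha
  have := mul_pos h0 hb
  linarith

theorem IsBetween.strictBetween {a c b : V} (h : IsBetween f g a c b) (hne : f a ≠ f b) :
    (f a < f c ∧ f c < f b) ∨ (f b < f c ∧ f c < f a) := by
  obtain ⟨t, h0, h1, hf, -⟩ := h
  rcases hne.lt_or_gt with hlt | hlt
  · left
    constructor <;> nlinarith
  · right
    constructor <;> nlinarith

theorem IsBetween.slope_eq {a c b : V} (h : IsBetween f g a c b) (ha : 0 < f a) (hb : 0 < f b)
    (hab : g a / f a = g b / f b) : g c / f c = g a / f a := by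
  have hc := h.pos ha.le hb
  obtain ⟨t, h0, h1, hf, hg⟩ := h
  rw [div_eq_div_iff ha.ne' hb.ne'] at hab
  rw [div_eq_div_iff hc.ne' ha.ne', hf, hg]
  linear_combination -t * hab

/-- The determinants of `a, c` and of `c, b` are `t` and `1 - t` times that of `a, b`, so all three
have the same sign. -/
theorem IsBetween.slope_lt {a c b : V} (h : IsBetween f g a c b) (ha : 0 < f a) (hb : 0 < f b)
    (hab : g a / f a < g b / f b) : g a / f a < g c / f c ∧ g c / f c < g b / f b := by
  have hc := h.pos ha.le hb
  obtain ⟨t, h0, h1, hf, hg⟩ := h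
  rw [div_lt_div_iff₀ ha hb] at hab
  have h1' := sub_pos.2 h1
  rw [div_lt_div_iff₀ ha hc, div_lt_div_iff₀ hc hb, hf, hg]
  constructor
  · linarith [mul_lt_mul_of_pos_left hab h0]
  · linarith [mul_lt_mul_of_pos_left hab h1']

theorem IsBetween.slope_eq_of_origin {p c b : V} (h : IsBetween f g p c b) (hfp : f p = 0)
    (hgp : g p = 0) : g c / f c = g b / f b := by
  obtain ⟨t, h0, h1, hf, hg⟩ := h
  rw [hf, hg, hfp, hgp, mul_zero, zero_add, zero_add, mul_div_mul_left _ _ h0.ne']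

variable [Fintype V] {G : SimpleGraph V}

/-- If all vertices lie on a line, the visibility graph is a path. -/
theorem isPathGraph_of_collinear (hf : Function.Injective f)
    (hadj : ∀ a b, G.Adj a b ↔ a ≠ b ∧ ∀ c, ¬ IsBetween f g a c b) (s : ℝ)
    (hs : ∀ x, g x = s * f x) : IsPathGraph G := by
  let _ : LinearOrder V := LinearOrder.lift' f hf
  have hlt : ∀ a b : V, a < b ↔ f a < f b := fun _ _ ↦ Iff.rfl
  refine isPathGraph_of_covBy G fun a b hab ↦ ?_
  rw [hadj]
  constructor
  · refine fun h ↦ ⟨hab, fun c hac hcb ↦ h.2 c ?_⟩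
    rw [hlt] at hab hac hcb
    have hpos : 0 < f b - f a := sub_pos.2 hab
    have hc : f c = (1 - (f c - f a) / (f b - f a)) * f a + (f c - f a) / (f b - f a) * f b := by
      field_simp
      ring
    refine ⟨(f c - f a) / (f b - f a), div_pos (sub_pos.2 hac) hpos,
      (div_lt_one hpos).2 (by linarith), hc, ?_⟩
    rw [hs a, hs b, hs c]
    linear_combination s * hc
  · refine fun h ↦ ⟨hab.ne, fun c hc ↦ ?_⟩
    rcases hc.strictBetween (ne_of_lt ((hlt _ _).1 hab)) with h' | h'
    · exact h.2 h'.1 h'.2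
    · exact (h'.1.trans h'.2).asymm hab

/-- Order the vertices by slope around an extreme vertex `p`, and along each ray by distance,
outwards on all rays but the last: this gives a Hamiltonian cycle. -/
theorem exists_isHamiltonianCycle_of_not_collinear [DecidableEq V] (hf : Function.Injective f)
    (hadj : ∀ a b, G.Adj a b ↔ a ≠ b ∧ ∀ c, ¬ IsBetween f g a c b) (p : V)
    (hfp : f p = 0) (hgp : g p = 0) (hpos : ∀ x, x ≠ p → 0 < f x)
    (hcol : ¬ ∃ s : ℝ, ∀ x, g x = s * f x) :
    ∃ (v : V) (c : G.Walk v v), c.IsHamiltonianCycle := by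
  classical
  have hcol' : ∀ s : ℝ, ∃ x, x ≠ p ∧ g x / f x ≠ s := by
    intro s
    by_contra! h
    refine hcol ⟨s, fun x ↦ ?_⟩
    by_cases hx : x = p
    · rw [hx, hfp, hgp, mul_zero]
    · exact (div_eq_iff (hpos x hx).ne').1 (h x hx)
  obtain ⟨x₀, hx₀, -⟩ := hcol' 0
  obtain ⟨q, hq, hmax⟩ := (Finset.univ.erase p).exists_max_image (fun x ↦ g x / f x)
    ⟨x₀, by simpa using hx₀⟩
  simp only [Finset.mem_erase, Finset.mem_univ, and_true] at hq hmax
  obtain ⟨r, hr, hrq⟩ := hcol' (g q / f q)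
  -- Along a ray from `p`, `f` measures distance; the sign flip on the ray of largest slope puts its
  -- nearest point last.
  let d : V → ℝ := fun x ↦ if g x / f x = g q / f q then - f x else f x
  -- The slope at `p` is the junk value `0 / 0`, so `p` is put first by `⊥`.
  let key : V → WithBot (ℝ ×ₗ ℝ) := fun x ↦ if x = p then ⊥ else ↑(toLex (g x / f x, d x))
  have key_of_ne : ∀ {x}, x ≠ p → key x = ↑(toLex (g x / f x, d x)) := fun h ↦ if_neg h
  have key_p : key p = ⊥ := if_pos rfl
  have hkey : Function.Injective key := by
    intro a b hab
    by_cases ha : a = p <;> by_cases hb : b = p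
    · rw [ha, hb]
    · rw [ha, key_p, key_of_ne hb] at hab
      exact (WithBot.bot_ne_coe hab).elim
    · rw [hb, key_p, key_of_ne ha] at hab
      exact (WithBot.coe_ne_bot hab).elim
    · rw [key_of_ne ha, key_of_ne hb, WithBot.coe_inj, toLex_inj, Prod.mk.injEq] at hab
      obtain ⟨h1, h2⟩ := hab
      simp only [d, h1] at h2
      split_ifs at h2
      · exact hf (neg_inj.1 h2)
      · exact hf h2
  let _ : LinearOrder V := LinearOrder.lift' key hkey
  have lt_iff : ∀ {a b : V}, a ≠ p → b ≠ p →
      (a < b ↔ g a / f a < g b / f b ∨ g a / f a = g b / f b ∧ d a < d b) := by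
    intro a b ha hb
    change key a < key b ↔ _
    rw [key_of_ne ha, key_of_ne hb, WithBot.coe_lt_coe, Prod.Lex.toLex_lt_toLex]
  have p_lt : ∀ {b : V}, b ≠ p → p < b := by
    intro b hb
    change key p < key b
    rw [key_p, key_of_ne hb]
    exact WithBot.bot_lt_coe _
  refine exists_isHamiltonianCycle_of_covBy G ?_ (fun a b hab ↦ ?_) (fun a b ha hb ↦ ?_)
  · rw [Fintype.two_lt_card_iff]
    exact ⟨p, q, r, hq.symm, hr.symm, fun h ↦ hrq (by rw [h])⟩
  · refine (hadj a b).2 ⟨hab.ne, fun c hc ↦ ?_⟩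
    have hb : b ≠ p := by
      rintro rfl
      exact (p_lt hab.ne).asymm hab.lt
    by_cases ha : a = p
    · subst ha
      have hslope := hc.slope_eq_of_origin hfp hgp
      have hfc := hc.strictBetween (hfp.trans_lt (hpos b hb)).ne
      rw [hfp] at hfc
      have hfb := hpos b hb
      have hca : c ≠ a := by
        rintro rfl
        rcases hfc with h | h <;> linarith
      -- Non-collinearity enters here: `r` has smaller slope than `q`, so the successor of `p` is
      -- not on the reversed ray.
      have hbq : g b / f b ≠ g q / f q := by
        intro h
        have hbr : ¬ r < b := fun h' ↦ hab.2 (p_lt hr) h'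
        rw [lt_iff hr hb] at hbr
        exact hbr (.inl (h ▸ (hmax r hr).lt_of_ne hrq))
      refine hab.2 (p_lt hca) ((lt_iff hca hb).2 (.inr ⟨hslope, ?_⟩))
      simp only [d, hslope, if_neg hbq]
      rcases hfc with h | h <;> linarith
    · have hfa := hpos a ha
      have hfb := hpos b hb
      have hcp : c ≠ p := by
        rintro rfl
        exact (hc.pos hfa.le hfb).ne' hfp
      rcases (lt_iff ha hb).1 hab.lt with h | ⟨h, hd⟩
      · obtain ⟨h1, h2⟩ := hc.slope_lt hfa hfb h
        exact hab.2 ((lt_iff ha hcp).2 (.inl h1)) ((lt_iff hcp hb).2 (.inl h2))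
      · have h1 := hc.slope_eq hfa hfb h
        have hfc := hc.strictBetween (hf.ne hab.ne)
        refine hab.2 ((lt_iff ha hcp).2 (.inr ⟨h1.symm, ?_⟩))
          ((lt_iff hcp hb).2 (.inr ⟨h1.trans h, ?_⟩))
        all_goals
          simp only [d, h1, h] at hd ⊢
          split_ifs at hd ⊢ <;> rcases hfc with h' | h' <;> linarith
  · have hap : a = p := by
      by_contra h
      exact (ha p).not_gt (p_lt h)
    subst hap
    have hba : b ≠ a := by
      rintro rfl
      exact (hb q).not_gt (p_lt hq)
    refine (hadj a b).2 ⟨hba.symm, fun c hc ↦ ?_⟩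
    have hslope := hc.slope_eq_of_origin hfp hgp
    have hfb := hpos b hba
    have hfc := hc.strictBetween (hfp.trans_lt hfb).ne
    rw [hfp] at hfc
    have hca : c ≠ a := by
      rintro rfl
      rcases hfc with h | h <;> linarith
    have hbq : g b / f b = g q / f q := by
      refine (hmax b hba).antisymm (not_lt.1 fun h ↦ ?_)
      exact (hb q).not_gt ((lt_iff hba hq).2 (.inl h))
    refine (hb c).not_gt ((lt_iff hba hca).2 (.inr ⟨hslope.symm, ?_⟩))
    simp only [d, hslope, if_pos hbq]
    rcases hfc with h | h <;> linarith

theorem isPathGraph_or_exists_isHamiltonianCycle [DecidableEq V] (hf : Function.Injective f)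
    (hadj : ∀ a b, G.Adj a b ↔ a ≠ b ∧ ∀ c, ¬ IsBetween f g a c b) :
    IsPathGraph G ∨ ∃ (v : V) (c : G.Walk v v), c.IsHamiltonianCycle := by
  rcases isEmpty_or_nonempty V with hV | hV
  · exact .inl ⟨0, ⟨⟨Equiv.equivOfIsEmpty _ _, fun {a} ↦ isEmptyElim a⟩⟩⟩
  obtain ⟨p, -, hp⟩ := Finset.univ.exists_min_image f Finset.univ_nonempty
  have hf' : Function.Injective fun x ↦ f x - f p := fun a b h ↦ hf (sub_left_injective h)
  have hadj' : ∀ a b, G.Adj a b ↔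
      a ≠ b ∧ ∀ c, ¬ IsBetween (fun x ↦ f x - f p) (fun x ↦ g x - g p) a c b := fun a b ↦ by
    rw [hadj]
    exact and_congr_right fun _ ↦ forall_congr' fun c ↦
      not_congr ⟨fun h ↦ h.sub_const _ _, fun h ↦ h.of_sub_const⟩
  by_cases hcol : ∃ s : ℝ, ∀ x, g x - g p = s * (f x - f p)
  · obtain ⟨s, hs⟩ := hcol
    exact .inl (isPathGraph_of_collinear hf' hadj' s hs)
  · exact .inr (exists_isHamiltonianCycle_of_not_collinear hf' hadj' p (sub_self _) (sub_self _)
      (fun x hx ↦ sub_pos.2 ((hp x (Finset.mem_univ x)).lt_of_ne (hf.ne hx.symm))) hcol)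

end Coordinates

end SimpleGraph

/-- Some linear functional `x + ε y` is injective on a given finite set of points of the plane. -/
theorem exists_injOn_add_mul (P : Finset (EuclideanSpace ℝ (Fin 2))) :
    ∃ ε : ℝ, Set.InjOn (fun v : EuclideanSpace ℝ (Fin 2) ↦ v 0 + ε * v 1) P := by
  -- Avoid the finitely many `ε` at which two points of different height tie; points of equal height
  -- never tie.
  obtain ⟨ε, hε⟩ := ((P ×ˢ P).image
    fun v : EuclideanSpace ℝ (Fin 2) × EuclideanSpace ℝ (Fin 2) ↦
      - (v.1 0 - v.2 0) / (v.1 1 - v.2 1)).finite_toSet.exists_notMem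
  refine ⟨ε, fun v hv w hw h ↦ ?_⟩
  simp only at h
  by_cases h1 : v 1 = w 1
  · ext i
    fin_cases i
    · simpa [h1] using h
    · exact h1
  · refine (hε ?_).elim
    rw [Finset.mem_coe, Finset.mem_image]
    refine ⟨(v, w), Finset.mem_product.2 ⟨hv, hw⟩, ?_⟩
    rw [div_eq_iff (sub_ne_zero.2 h1)]
    linear_combination -h

/-- The shear `(x, y) ↦ (x + ε y, y)` is linear and invertible, so it preserves betweenness. -/
theorem pointVisibilityGraph_adj_iff {P : Set (EuclideanSpace ℝ (Fin 2))} {ε : ℝ}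
    (hε : Set.InjOn (fun v : EuclideanSpace ℝ (Fin 2) ↦ v 0 + ε * v 1) P) (a b : P) :
    (pointVisibilityGraph P).Adj a b ↔ a ≠ b ∧ ∀ c : P, ¬ SimpleGraph.IsBetween
      (fun v : P ↦ v.1 0 + ε * v.1 1) (fun v : P ↦ v.1 1) a c b := by
  refine and_congr_right fun hne ↦ ⟨fun h c hc ↦ ?_, fun h ↦ ?_⟩
  · have hne' := hε.ne a.2 b.2 (Subtype.coe_injective.ne hne)
    have hbet := hc.strictBetween hne'
    obtain ⟨t, h0, h1, hf, hg⟩ := hc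
    have hmem : c.1 ∈ P ∩ segment ℝ a.1 b.1 := by
      refine ⟨c.2, 1 - t, t, by linarith, h0.le, by ring, ?_⟩
      ext i
      fin_cases i
      · simp only [Fin.zero_eta, PiLp.add_apply, PiLp.smul_apply, smul_eq_mul]
        linear_combination -hf + ε * hg
      · simp only [Fin.mk_one, PiLp.add_apply, PiLp.smul_apply, smul_eq_mul]
        exact hg.symm
    rw [h] at hmem
    rcases hmem with hca | hcb
    · simp only [hca] at hbet
      rcases hbet with h' | h'
      · exact h'.1.false
      · exact h'.2.false
    · rw [Set.mem_singleton_iff] at hcb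
      simp only [hcb] at hbet
      rcases hbet with h' | h'
      · exact h'.2.false
      · exact h'.1.false
  · refine Set.Subset.antisymm ?_ ?_
    · rintro c ⟨hcP, hc⟩
      rw [← insert_endpoints_openSegment] at hc
      rcases hc with rfl | rfl | ⟨u, t, hu, ht, hut, rfl⟩
      · exact Set.mem_insert _ _
      · exact Set.mem_insert_of_mem _ rfl
      · obtain rfl : u = 1 - t := by linarith
        refine (h ⟨_, hcP⟩ ⟨t, ht, by linarith, ?_, ?_⟩).elim
        · simp only [PiLp.add_apply, PiLp.smul_apply, smul_eq_mul]
          ring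
        · simp only [PiLp.add_apply, PiLp.smul_apply, smul_eq_mul]
    · rintro c (rfl | rfl)
      · exact ⟨a.2, left_mem_segment ℝ _ _⟩
      · exact ⟨b.2, right_mem_segment ℝ _ _⟩

theorem theorem1 {V : Type*} [DecidableEq V] (G : SimpleGraph V)
    (hG : IsPVG G) (hpath : ¬ IsPathGraph G) :
    ∃ (v : V) (c : G.Walk v v), c.IsHamiltonianCycle := by
  obtain ⟨P, ⟨φ⟩⟩ := hG
  obtain ⟨ε, hε⟩ := exists_injOn_add_mul P
  have := Fintype.ofEquiv _ φ.symm.toEquiv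
  refine (SimpleGraph.isPathGraph_or_exists_isHamiltonianCycle
    (f := fun x ↦ (φ x).1 0 + ε * (φ x).1 1) (g := fun x ↦ (φ x).1 1)
    (hε.injective.comp φ.injective) fun a b ↦ ?_).resolve_left hpath
  rw [← φ.map_adj_iff, pointVisibilityGraph_adj_iff hε, φ.injective.ne_iff]
  exact and_congr_right fun _ ↦ (φ.surjective.forall)
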